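/- **Setting.** Consider a fully connected ReLU network $f(x)=W_L\phi(a_{L-1})+b_L$, $\mathbb R^n\to\mathbb R^m$, of depth $L\ge 1$, where $a_i=W_i\phi(a_{i-1})+b_i$ for $1\le i\le L-1$, $\phi(a_0):=x$, and $\phi(a)=\max(0,a)$ entrywise. Put $\phi'(a)=1$ if $a\ge 0$ and $\phi'(a)=0$ otherwise, entrywise. Let $\gamma>0$. The network is trained offline with spectral normalization: there is at least one epoch, and each epoch consists of an arbitrary update of all parameters followed, for every $i=1,\dots,L$, by the replacement of $W_i$ by $\gamma^{1/L}W_i/\sigma(W_i)$ if $\sigma(W_i)>\gamma^{1/L}$, where $\sigma$ is the largest singular value. Online, the hidden layers $W_i,b_i$ ($i<L$) stay fixed, the input is a $C^1$ signal $x(t)$ with an estimate $\dot{\hat x}(t)$ of $\dot x(t)$, and the target is a $C^2$ signal $y'(t)\in\mathbb R^m$ with $|\ddot y'_i(t)|\le D_y$ for $t\ge0$ and every component $i$. For $v\in\mathbb R^n$ let $$\Gamma(v)=W_L\bigl(\phi'(a_{L-1})\odot W_{L-1}(\phi'(a_{L-2})\odot W_{L-2}(\cdots\phi'(a_1)\odot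 W_1v))\bigr),\qquad \Gamma=\Gamma(\dot x),\quad \hat\Gamma=\Gamma(\dot{\hat x}).$$ With $\hat y=f(x)$ and $e_1=\hat y-y'$, the last layer and an auxiliary state $\hat z_2\in\mathbb R^m$ evolve by $$\dot b_L=\tfrac12\bigl(-k_1|e_1|^{1/2}\mathrm{sign}(e_1)-\hat\Gamma+\hat z_2\bigr),\qquad \dot W_L=\dot b_L\,\frac{\phi(a_{L-1})^T}{\|\phi(a_{L-1})\|_2^2},\qquad \dot{\hat z}_2=-k_2\,\mathrm{sign}(e_1),$$ entrywise in $e_1$. Solutions on $[0,\infty)$ are taken in the sense of Filippov (locally absolutely continuous, laws satisfied for almost every $t$, and $\mathrm{sign}(0)$ in the last law replaced by $[-1,1]$), with $\phi(a_{L-1})\ne0$ for almost every $t$. Their initial values, including $W_L(0)$, are arbitrary. Put $e_2=\hat z_2-\dot y'$. **Theorem.** For every $D_y>0$ there are gains $k_1,k_2>0$ and $\bar\delta>0$, depending only on $D_y$, such that the following hold for all layer widths, all $L\ge1$ and all $\gamma>0$. 1. For all $\delta_1\ge0$ and $0\le\delta_2<\bar\delta$, the error trajectories $(e_1,e_2)$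 of all such systems whose perturbation $p_1=\Gamma-\hat\Gamma$ satisfies, for every component $i$ and almost every $t\ge0$, $$|p_{1,i}|\le\delta_1+\delta_2\sqrt{|e_{1,i}|+e_{2,i}^2}$$ are globally ultimately bounded: there is $b>0$ such that for every $a>0$ there is $T\ge0$ such that, for each of these trajectories and all $t_0\ge0$, $\|(e_1,e_2)(t_0)\|\le a$ implies $\|(e_1,e_2)(t)\|\le b$ for all $t\ge t_0+T$. 2. For the trained weights (including the trained $W_L$), at every input $x$ and for all $v,\hat v\in\mathbb R^n$, $\|\Gamma(v)-\Gamma(\hat v)\|_2\le\gamma\|v-\hat v\|_2$. If $W_L$ is replaced by an arbitrary matrix, such as its current value $W_L(t)$ during the online adaptation, and the hidden layers are the trained ones, then $\|\Gamma(v)-\Gamma(\hat v)\|_2\le\sigma(W_L)\,\gamma^{(L-1)/L}\,\|v-\hat v\|_2$. In particular $\|\Gamma-\hat\Gamma\|_2\le\gamma\|\dot x-\dot{\hat x}\|_2$ at every time at which $\sigma(W_L(t))\le\gamma^{1/L}$. -/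

import Mathlib

open MeasureTheory Set

noncomputable section

namespace OnlineDNN

/-- Euclidean space `ℝᵏ` (with the 2-norm). -/
abbrev Vec (k : ℕ) : Type := EuclideanSpace ℝ (Fin k)

/-- A matrix as a continuous linear map between Euclidean spaces. -/
def lin {k l : ℕ} (A : Matrix (Fin l) (Fin k) ℝ) : Vec k →L[ℝ] Vec l :=
  (Matrix.toEuclideanLin A).toContinuousLinearMap

/-- The maximum singular value `σ(A)`, as the operator norm for the 2-norms. -/
def sigmaMax {k l : ℕ} (A : Matrix (Fin l) (Fin k) ℝ) : ℝ := ‖lin A‖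

/-! ### ReLU networks -/

/-- Weights and biases of a fully connected network with layer widths `d 0` (input), `d 1`, ….
`W i`, `b i` belong to layer number `i + 1`. A network with `H` hidden layers (depth `L = H + 1`)
only uses the entries with index `i ≤ H`; index `H` is the output layer. -/
structure Params (d : ℕ → ℕ) where
  W : ∀ i : ℕ, Matrix (Fin (d (i + 1))) (Fin (d i)) ℝ
  b : ∀ i : ℕ, Vec (d (i + 1))

/-- The ReLU activation, entrywise. -/
def relu {k : ℕ} (a : Vec k) : Vec k := WithLp.toLp 2 fun j => max 0 (a j)

/-- The activation derivative `φ'`: `1` on `[0, ∞)` and `0` elsewhere, entrywise. -/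
def reluDeriv {k : ℕ} (a : Vec k) : Vec k := WithLp.toLp 2 fun j => if 0 ≤ a j then 1 else 0

/-- Entrywise (Hadamard) product. -/
def hadamard {k : ℕ} (u v : Vec k) : Vec k := WithLp.toLp 2 fun j => u j * v j

/-- `feature θ x i` is the output `φ(a_i)` of the `i`-th hidden layer at the input `x`
(the input itself for `i = 0`). -/
def feature {d : ℕ → ℕ} (θ : Params d) (x : Vec (d 0)) : (i : ℕ) → Vec (d i)
  | 0 => x
  | i + 1 => relu (lin (θ.W i) (feature θ x i) + θ.b i)

/-- The pre-activation `a_{i+1} = W_{i+1} φ(a_i) + b_{i+1}` at the input `x`. -/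
def preact {d : ℕ → ℕ} (θ : Params d) (x : Vec (d 0)) (i : ℕ) : Vec (d (i + 1)) :=
  lin (θ.W i) (feature θ x i) + θ.b i

/-- The chain-rule expression
`φ'(a_i) ⊙ W_i (φ'(a_{i-1}) ⊙ W_{i-1} (⋯ φ'(a_1) ⊙ W_1 v))` for the time derivative of `φ(a_i)`
at an input `x` with input velocity `v`. -/
def featureDeriv {d : ℕ → ℕ} (θ : Params d) (x v : Vec (d 0)) : (i : ℕ) → Vec (d i)
  | 0 => v
  | i + 1 => hadamard (reluDeriv (preact θ x i)) (lin (θ.W i) (featureDeriv θ x v i))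

/-- `Γ(v)` for the hidden layers of `θ` at the input `x` and the output weight `WL`. -/
def Gam {d : ℕ → ℕ} (θ : Params d) (H : ℕ) (WL : Matrix (Fin (d (H + 1))) (Fin (d H)) ℝ)
    (x v : Vec (d 0)) : Vec (d (H + 1)) :=
  lin WL (featureDeriv θ x v H)

/-- Network output for the hidden layers of `θ` and the output layer `(WL, bL)`. -/
def output {d : ℕ → ℕ} (θ : Params d) (H : ℕ) (WL : Matrix (Fin (d (H + 1))) (Fin (d H)) ℝ)
    (bL : Vec (d (H + 1))) (x : Vec (d 0)) : Vec (d (H + 1)) :=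
  lin WL (feature θ x H) + bL

/-! ### Spectrally normalized training -/

/-- If `σ(A) > c`, rescale `A` so that its maximum singular value is `c`. -/
def normalizeMatrix {k l : ℕ} (c : ℝ) (A : Matrix (Fin l) (Fin k) ℝ) :
    Matrix (Fin l) (Fin k) ℝ :=
  if c < sigmaMax A then (c / sigmaMax A) • A else A

/-- Normalize the weights of all `L = H + 1` layers with the threshold `γ ^ (1 / L)`. -/
def normalizeLayers {d : ℕ → ℕ} (γ : ℝ) (H : ℕ) (θ : Params d) : Params d where
  W i := if i ≤ H then normalizeMatrix (γ ^ (1 / ((H : ℝ) + 1))) (θ.W i) else θ.W i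
  b := θ.b

/-- Parameters after a given number of epochs. In epoch `n` an arbitrary parameter update `opt n`
(the optimizer together with its data) is followed by the normalization of all layers. -/
def train {d : ℕ → ℕ} (γ : ℝ) (H : ℕ) (opt : ℕ → Params d → Params d) (θ₀ : Params d) :
    ℕ → Params d
  | 0 => θ₀
  | n + 1 => normalizeLayers γ H (opt n (train γ H opt θ₀ n))

/-- `θ` is the result of at least one epoch of spectrally normalized training. -/
def IsSpectrallyTrained {d : ℕ → ℕ} (γ : ℝ) (H : ℕ) (θ : Params d) : Prop :=
  ∃ (opt : ℕ → Params d → Params d) (θ₀ : Params d) (epochs : ℕ),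
    1 ≤ epochs ∧ θ = train γ H opt θ₀ epochs

/-! ### The online update laws -/

/-- The set-valued sign: the Filippov regularization of the sign function. -/
def signSet (u : ℝ) : Set ℝ := if 0 < u then {1} else if u < 0 then {-1} else Icc (-1) 1

/-- Absolutely continuous on every compact interval `[0, T]`. -/
def LocallyAC (f : ℝ → ℝ) : Prop := ∀ T : ℝ, 0 ≤ T → AbsolutelyContinuousOnInterval f 0 T

/-- First error `e₁ = ŷ - y'`. -/
def err₁ {d : ℕ → ℕ} (θ : Params d) (H : ℕ) (x : ℝ → Vec (d 0)) (y : ℝ → Vec (d (H + 1)))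
    (WL : ℝ → Matrix (Fin (d (H + 1))) (Fin (d H)) ℝ) (bL : ℝ → Vec (d (H + 1))) (t : ℝ) :
    Vec (d (H + 1)) :=
  output θ H (WL t) (bL t) (x t) - y t

/-- Second error `e₂ = ẑ₂ - dy'/dt`. -/
def err₂ {m : ℕ} (y z₂ : ℝ → Vec m) (t : ℝ) : Vec m := z₂ t - deriv y t

/-- The right-hand side of the bias update law with `Γ̂ = G`, entrywise:
`½ (-k₁ |e₁|^{1/2} sign e₁ - G + ẑ₂)`. -/
def biasRate {m : ℕ} (k₁ : ℝ) (e₁ G z₂ : Vec m) (i : Fin m) : ℝ :=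
  1 / 2 * (-k₁ * Real.sqrt |e₁ i| * Real.sign (e₁ i) - G i + z₂ i)

/-- `(WL, bL, z₂)` is a Filippov solution on `[0, ∞)` of the update laws that use
`Γ̂ = Γ(v̂)`, with input signal `x`, estimate `v̂` of its time derivative, and target `y`. The laws
divide by `‖φ(a_{L-1})‖²`, which therefore must not vanish. -/
structure IsOnlineSolution {d : ℕ → ℕ} (θ : Params d) (H : ℕ) (k₁ k₂ : ℝ)
    (x vhat : ℝ → Vec (d 0)) (y : ℝ → Vec (d (H + 1)))
    (WL : ℝ → Matrix (Fin (d (H + 1))) (Fin (d H)) ℝ) (bL z₂ : ℝ → Vec (d (H + 1))) : Prop where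
  ac_weight : ∀ i j, LocallyAC fun t => WL t i j
  ac_bias : ∀ i, LocallyAC fun t => bL t i
  ac_integral : ∀ i, LocallyAC fun t => z₂ t i
  feature_ne_zero : ∀ᵐ t ∂volume.restrict (Ici (0 : ℝ)), feature θ (x t) H ≠ 0
  bias_law : ∀ᵐ t ∂volume.restrict (Ici (0 : ℝ)), ∀ i,
    HasDerivAt (fun s => bL s i)
      (biasRate k₁ (err₁ θ H x y WL bL t) (Gam θ H (WL t) (x t) (vhat t)) (z₂ t) i) t
  weight_law : ∀ᵐ t ∂volume.restrict (Ici (0 : ℝ)), ∀ i j,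
    HasDerivAt (fun s => WL s i j)
      (biasRate k₁ (err₁ θ H x y WL bL t) (Gam θ H (WL t) (x t) (vhat t)) (z₂ t) i
        * feature θ (x t) H j / ‖feature θ (x t) H‖ ^ 2) t
  integral_law : ∀ᵐ t ∂volume.restrict (Ici (0 : ℝ)), ∀ i,
    ∃ s ∈ signSet (err₁ θ H x y WL bL t i), HasDerivAt (fun r => z₂ r i) (-k₂ * s) t

/-- The perturbation `p₁ = Γ - Γ̂` of the first channel satisfies, entrywise and for almost all
`t ≥ 0`, the bound `|p₁| ≤ δ₁ + δ₂ √(|e₁| + e₂²)`. -/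
def PerturbationBound {d : ℕ → ℕ} (θ : Params d) (H : ℕ) (δ₁ δ₂ : ℝ)
    (x vhat : ℝ → Vec (d 0)) (y : ℝ → Vec (d (H + 1)))
    (WL : ℝ → Matrix (Fin (d (H + 1))) (Fin (d H)) ℝ) (bL z₂ : ℝ → Vec (d (H + 1))) : Prop :=
  ∀ᵐ t ∂volume.restrict (Ici (0 : ℝ)), ∀ i,
    |Gam θ H (WL t) (x t) (deriv x t) i - Gam θ H (WL t) (x t) (vhat t) i|
      ≤ δ₁ + δ₂ * Real.sqrt (|err₁ θ H x y WL bL t i| + err₂ y z₂ t i ^ 2)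

/-- All error trajectories `t ↦ (e₁ t, e₂ t)` of networks of the given architecture. The initial
values of `WL`, `bL`, `z₂` are arbitrary. -/
def errorTrajectories (d : ℕ → ℕ) (H : ℕ) (γ Dy k₁ k₂ δ₁ δ₂ : ℝ) :
    Set (ℝ → Vec (d (H + 1)) × Vec (d (H + 1))) :=
  {e | ∃ (θ : Params d) (x vhat : ℝ → Vec (d 0)) (y : ℝ → Vec (d (H + 1)))
      (WL : ℝ → Matrix (Fin (d (H + 1))) (Fin (d H)) ℝ) (bL z₂ : ℝ → Vec (d (H + 1))),
      IsSpectrallyTrained γ H θ ∧ ContDiff ℝ 1 x ∧ ContDiff ℝ 2 y ∧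
      (∀ t, 0 ≤ t → ∀ i, |deriv (deriv y) t i| ≤ Dy) ∧
      IsOnlineSolution θ H k₁ k₂ x vhat y WL bL z₂ ∧
      PerturbationBound θ H δ₁ δ₂ x vhat y WL bL z₂ ∧
      ∀ t, e t = (err₁ θ H x y WL bL t, err₂ y z₂ t)}

/-- Global (uniform) ultimate boundedness of a family of trajectories on `[0, ∞)`: there is one
bound `b` such that for every `a` there is `T` (independent of the initial time `t₀`) with
`‖e t₀‖ ≤ a → ‖e t‖ ≤ b` for all `t ≥ t₀ + T`. -/
def GloballyUltimatelyBounded {F : Type*} [Norm F] (S : Set (ℝ → F)) : Prop :=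
  ∃ b : ℝ, 0 < b ∧ ∀ a : ℝ, 0 < a → ∃ T : ℝ, 0 ≤ T ∧
    ∀ e ∈ S, ∀ t₀ : ℝ, 0 ≤ t₀ → ‖e t₀‖ ≤ a → ∀ t : ℝ, t₀ + T ≤ t → ‖e t‖ ≤ b

end OnlineDNN

end

noncomputable section

namespace OnlineDNN

/-! ### Absolutely continuous functions -/

/-! Part 1. The weight law moves `W_L φ` exactly as fast as `b_L` moves, so the output velocity is
`2 ḃ_L + Γ` and each error component obeys, on its own, the super-twisting system `e₁' = -k₁ √|e₁|
sign e₁ + e₂ + p₁`, `e₂' ∈ -k₂ sign e₁ - y''` (`ae_hasDerivAt_err₁`, `ae_hasDerivAt_err₂`). Division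
by `Dy` normalizes the gains to 3 and 2 and the drift to `|q| ≤ 1`. With `N² = |u| + v²`, the
function `lyapunov` decreases at rate at least `2/5 N²` when `p = 0`, and its `u`-derivative is at
most `13 N`. Hence `p` costs at most `13 N (δ₁ + δ₂ N)`, half of that decrease once `δ₂ ≤ 1/130` and
`N ≥ 130 δ₁`. Outside a fixed sublevel set the function falls at rate at least `1/5`, so that set is
reached in a time controlled by the initial size and is never left (`superTwisting_ultimate_bound`).
Part 2. For fixed `x` the masks are fixed 0/1 vectors, so `Γ` is linear in `v` and its norm is at
most the product of the layer norms. -/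

theorem _root_.LocallyLipschitz.comp_absolutelyContinuousOnInterval {h f : ℝ → ℝ} {a b : ℝ}
    (hh : LocallyLipschitz h) (hf : AbsolutelyContinuousOnInterval f a b) :
    AbsolutelyContinuousOnInterval (fun t => h (f t)) a b := by
  have hK : IsCompact (f '' uIcc a b) := isCompact_uIcc.image_of_continuousOn hf.continuousOn
  obtain ⟨K, hL⟩ :=
    (hh.locallyLipschitzOn (s := f '' uIcc a b)).exists_lipschitzOnWith_of_compact hK
  rw [absolutelyContinuousOnInterval_iff] at hf ⊢
  intro ε hε
  -- `K + 1` instead of `K` avoids division by zero.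
  obtain ⟨δ, hδ, hE⟩ := hf (ε / (K + 1)) (by positivity)
  refine ⟨δ, hδ, fun E hmem hlen => ?_⟩
  have h1 := hE E hmem hlen
  calc ∑ i ∈ Finset.range E.1, dist (h (f (E.2 i).1)) (h (f (E.2 i).2))
      ≤ ∑ i ∈ Finset.range E.1, (K + 1 : ℝ) * dist (f (E.2 i).1) (f (E.2 i).2) := by
        refine Finset.sum_le_sum fun i hi => ?_
        have h2 := hmem.1 i hi
        refine (hL.dist_le_mul _ (mem_image_of_mem f h2.1) _ (mem_image_of_mem f h2.2)).trans ?_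
        gcongr
        linarith
    _ = (K + 1 : ℝ) * ∑ i ∈ Finset.range E.1, dist (f (E.2 i).1) (f (E.2 i).2) := by
        rw [Finset.mul_sum]
    _ < (K + 1 : ℝ) * (ε / (K + 1)) := by gcongr
    _ = ε := by field_simp

namespace LocallyAC

variable {f g : ℝ → ℝ}

theorem add (hf : LocallyAC f) (hg : LocallyAC g) : LocallyAC fun t => f t + g t :=
  fun T hT => (hf T hT).fun_add (hg T hT)

theorem sub (hf : LocallyAC f) (hg : LocallyAC g) : LocallyAC fun t => f t - g t :=
  fun T hT => (hf T hT).fun_sub (hg T hT)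

theorem mul (hf : LocallyAC f) (hg : LocallyAC g) : LocallyAC fun t => f t * g t :=
  fun T hT => (hf T hT).mul (hg T hT)

theorem const_mul (c : ℝ) (hf : LocallyAC f) : LocallyAC fun t => c * f t :=
  fun T hT => (hf T hT).const_mul c

theorem of_contDiff (hf : ContDiff ℝ 1 f) : LocallyAC f :=
  fun _ _ => hf.contDiffOn.absolutelyContinuousOnInterval

theorem const (c : ℝ) : LocallyAC fun _ => c := of_contDiff contDiff_const

theorem comp {h : ℝ → ℝ} (hh : LocallyLipschitz h) (hf : LocallyAC f) :
    LocallyAC fun t => h (f t) :=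
  fun T hT => hh.comp_absolutelyContinuousOnInterval (hf T hT)

theorem sum {ι : Type*} (s : Finset ι) {F : ι → ℝ → ℝ} (hF : ∀ i, LocallyAC (F i)) :
    LocallyAC fun t => ∑ i ∈ s, F i t := by
  classical
  induction s using Finset.induction_on with
  | empty => simpa using const 0
  | insert a s ha ih => simpa [Finset.sum_insert ha] using (hF a).add ih

theorem on_interval (hf : LocallyAC f) {a b : ℝ} (ha : 0 ≤ a) (hab : a ≤ b) :
    AbsolutelyContinuousOnInterval f a b :=
  (hf b (ha.trans hab)).mono (by
    rw [uIcc_of_le hab, uIcc_of_le (ha.trans hab)]; exact Icc_subset_Icc_left ha)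

theorem continuousOn (hf : LocallyAC f) : ContinuousOn f (Ici 0) := by
  intro t ht
  have ht : (0 : ℝ) ≤ t := ht
  have h := (hf (t + 1) (by linarith)).continuousOn t (by rw [uIcc_of_le (by linarith)]; grind)
  refine h.mono_of_mem_nhdsWithin ?_
  rw [uIcc_of_le (by linarith)]
  filter_upwards [self_mem_nhdsWithin, mem_nhdsWithin_of_mem_nhds (Iio_mem_nhds (lt_add_one t))]
    with s hs hs'
  exact ⟨hs, le_of_lt hs'⟩

/-- The mean value inequality for absolutely continuous functions. -/
theorem sub_le_of_deriv_le (hf : LocallyAC f) {a b c : ℝ} (ha : 0 ≤ a) (hab : a ≤ b)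
    (hd : ∀ᵐ t, t ∈ Ioo a b → deriv f t ≤ c) : f b - f a ≤ c * (b - a) := by
  have hac := hf.on_interval ha hab
  rw [← hac.integral_deriv_eq_sub]
  have h := intervalIntegral.integral_mono_ae_restrict hab hac.intervalIntegrable_deriv
    (intervalIntegrable_const (c := c)) (by
      rw [← restrict_Ioo_eq_restrict_Icc]
      exact (ae_restrict_iff' measurableSet_Ioo).2 hd)
  simpa [mul_comm] using h

/-- A function that decreases at rate `η` wherever it exceeds `M` does so until it reaches `M`,
and stays below `M` from then on. -/
theorem le_max_of_deriv_le (hf : LocallyAC f) {M η : ℝ} (hη : 0 ≤ η)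
    (hd : ∀ᵐ t ∂volume.restrict (Ici (0 : ℝ)), M < f t → deriv f t ≤ -η)
    {t₀ t : ℝ} (ht₀ : 0 ≤ t₀) (ht : t₀ ≤ t) : f t ≤ max M (f t₀ - η * (t - t₀)) := by
  by_contra! hcon
  obtain ⟨hM, hdec⟩ := max_lt_iff.1 hcon
  rw [ae_restrict_iff' measurableSet_Ici] at hd
  by_cases hex : ∀ s ∈ Icc t₀ t, M < f s
  · have h := hf.sub_le_of_deriv_le ht₀ ht (c := -η) (by
      filter_upwards [hd] with s hs hmem
      exact hs (ht₀.trans hmem.1.le) (hex s ⟨hmem.1.le, hmem.2.le⟩))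
    linarith
  · push Not at hex
    have hcont : ContinuousOn f (Icc t₀ t) := hf.continuousOn.mono fun s hs => ht₀.trans hs.1
    have hcpt : IsCompact (Icc t₀ t ∩ f ⁻¹' Iic M) :=
      isCompact_Icc.of_isClosed_subset (hcont.preimage_isClosed_of_isClosed isClosed_Icc isClosed_Iic)
        inter_subset_left
    -- `τ` is the last time with `f ≤ M`; after it `f` cannot increase, contradicting `M < f t`.
    obtain ⟨τ, hτ, hmax⟩ := hcpt.exists_isGreatest (by
      obtain ⟨s, hs, hs'⟩ := hex
      exact ⟨s, hs, hs'⟩)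
    have hτM : f τ ≤ M := hτ.2
    have h := hf.sub_le_of_deriv_le (ht₀.trans hτ.1.1) hτ.1.2 (c := 0) (by
      filter_upwards [hd] with s hs hmem
      have : M < f s := by
        by_contra! hle
        exact (hmax ⟨⟨hτ.1.1.trans hmem.1.le, hmem.2.le⟩, hle⟩).not_gt hmem.1
      linarith [hs (ht₀.trans (hτ.1.1.trans hmem.1.le)) this])
    linarith

end LocallyAC

/-! ### The Lyapunov function of the super-twisting dynamics -/

/-- A continuously differentiable Lyapunov function, homogeneous of degree `3` for the weights
`(2, 1)`, of the super-twisting dynamics with gains `3` and `2`. -/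
def lyapunov (u v : ℝ) : ℝ := 8 * |u| ^ (3 / 2 : ℝ) - 4 * (u * v) + 1 / 3 * |v| ^ (3 : ℝ)

theorem locallyLipschitz_abs_rpow {p : ℝ} (hp : 1 < p) :
    LocallyLipschitz fun u : ℝ => |u| ^ p := by
  have h : ContDiff ℝ 1 fun u : ℝ => ‖u‖ ^ p := contDiff_norm_rpow hp
  exact h.locallyLipschitz

/-- Both exponents exceed 1, so the function is C¹, also across `u = 0`; absolute continuity
survives composition and the decrease can be integrated. -/
theorem locallyAC_lyapunov {u v : ℝ → ℝ} (hu : LocallyAC u) (hv : LocallyAC v) :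
    LocallyAC fun t => lyapunov (u t) (v t) :=
  (((hu.comp (locallyLipschitz_abs_rpow (by norm_num))).const_mul 8).sub
    ((hu.mul hv).const_mul 4)).add
    ((hv.comp (locallyLipschitz_abs_rpow (by norm_num))).const_mul (1 / 3))

theorem abs_rpow_three_halves (u : ℝ) : |u| ^ (3 / 2 : ℝ) = √|u| ^ 3 := by
  rw [Real.sqrt_eq_rpow, ← Real.rpow_natCast, ← Real.rpow_mul (abs_nonneg u)]
  norm_num

theorem lyapunov_eq (u v : ℝ) : lyapunov u v = 8 * √|u| ^ 3 - 4 * (u * v) + 1 / 3 * |v| ^ 3 := by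
  rw [lyapunov, abs_rpow_three_halves]
  norm_cast

theorem abs_rpow_neg_half_mul (u : ℝ) : |u| ^ (3 / 2 - 2 : ℝ) * u = √|u| * Real.sign u := by
  rcases lt_trichotomy u 0 with h | h | h
  · rw [Real.sign_of_neg h, abs_of_neg h, Real.sqrt_eq_rpow]
    have : (-u) ^ (3 / 2 - 2 : ℝ) * (-u) = (-u) ^ (1 / 2 : ℝ) := by
      conv_lhs => rw [← Real.rpow_add_one (by linarith)]
      norm_num
    linarith
  · simp [h]
  · rw [Real.sign_of_pos h, abs_of_pos h, Real.sqrt_eq_rpow, ← Real.rpow_add_one h.ne']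
    norm_num

theorem hasDerivAt_lyapunov {u v : ℝ → ℝ} {u' v' t : ℝ} (hu : HasDerivAt u u' t)
    (hv : HasDerivAt v v' t) :
    HasDerivAt (fun s => lyapunov (u s) (v s))
      ((12 * (√|u t| * Real.sign (u t)) - 4 * v t) * u' + (-4 * u t + |v t| * v t) * v') t := by
  have h1 := (hasDerivAt_abs_rpow (u t) (p := 3 / 2) (by norm_num)).comp t hu
  have h2 := (hasDerivAt_abs_rpow (v t) (p := 3) (by norm_num)).comp t hv
  have h := ((h1.const_mul 8).sub ((hu.mul hv).const_mul 4)).add (h2.const_mul (1 / 3))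
  refine h.congr_deriv ?_
  rw [show (3 - 2 : ℝ) = 1 by norm_num, Real.rpow_one, mul_assoc (3 / 2 : ℝ) _ (u t),
    abs_rpow_neg_half_mul]
  ring

theorem abs_mul_le_sqrt_sq_mul (u v : ℝ) : |u * v| = √|u| ^ 2 * |v| := by
  rw [Real.sq_sqrt (abs_nonneg u), abs_mul]

theorem le_lyapunov (u v : ℝ) : √|u| ^ 3 + |v| ^ 3 / 12 ≤ lyapunov u v := by
  have h := le_abs_self (u * v)
  rw [abs_mul_le_sqrt_sq_mul] at h
  rw [lyapunov_eq]
  have hs := Real.sqrt_nonneg |u|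
  have hw := abs_nonneg v
  set s := √|u|
  set w := |v|
  -- The claim is `7 s³ - 4 s² w + w³ / 4 ≥ 0`, tightest at `w / s = 4 / √3`, close to the root
  -- `7/3` of the squares.
  nlinarith [mul_nonneg hw (sq_nonneg (3 * w - 7 * s)), mul_nonneg hs (sq_nonneg (3 * w - 7 * s)),
    pow_nonneg hs 3]

theorem lyapunov_le {u v R : ℝ} (hu : √|u| ≤ R) (hv : |v| ≤ R) : lyapunov u v ≤ 13 * R ^ 3 := by
  have h := neg_abs_le (u * v)
  rw [abs_mul_le_sqrt_sq_mul] at h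
  have hs := Real.sqrt_nonneg |u|
  have hw := abs_nonneg v
  have h1 : √|u| ^ 3 ≤ R ^ 3 := by gcongr
  have h2 : |v| ^ 3 ≤ R ^ 3 := by gcongr
  have h3 : √|u| ^ 2 * |v| ≤ R ^ 2 * R := by gcongr
  have h4 : 0 ≤ R ^ 3 := pow_nonneg (hw.trans hv) 3
  rw [lyapunov_eq]
  nlinarith

/-- By symmetry `u ≥ 0` may be assumed; then `s = √u`, `w = v`, and `c = 2 ± q` is the effective
gain. The left side is affine in `c`, so for `w ≥ 0` two definite quadratic forms, at `c = 1` and `c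
= 3`, suffice. For `w ≤ 0` the cross term has the good sign. -/
theorem superTwisting_quadratic {s w c : ℝ} (hs : 0 ≤ s) (hc₁ : 1 ≤ c) (hc₃ : c ≤ 3) :
    (12 * s - 4 * w) * (-3 * s + w) + (-4 * s ^ 2 + |w| * w) * -c
      ≤ -(2 / 5) * (s ^ 2 + w ^ 2) := by
  rcases le_total 0 w with hw | hw
  · rw [abs_of_nonneg hw]
    have h1 : -32 * s ^ 2 + 24 * s * w - 5 * w ^ 2 + 2 / 5 * (s ^ 2 + w ^ 2) ≤ 0 := by
      nlinarith [sq_nonneg (5 * s - 2 * w)]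
    have h3 : -24 * s ^ 2 + 24 * s * w - 7 * w ^ 2 + 2 / 5 * (s ^ 2 + w ^ 2) ≤ 0 := by
      nlinarith [sq_nonneg (2 * s - w)]
    nlinarith [mul_nonneg (sub_nonneg.2 hc₃) (neg_nonneg.2 h1),
      mul_nonneg (sub_nonneg.2 hc₁) (neg_nonneg.2 h3)]
  · rw [abs_of_nonpos hw]
    nlinarith [mul_nonneg hs (neg_nonneg.2 hw), mul_nonneg (sub_nonneg.2 hc₃) (sq_nonneg s),
      mul_nonneg (sub_nonneg.2 hc₃) (sq_nonneg w), sq_nonneg s, sq_nonneg w]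

/-- Decrease of the Lyapunov function along the dynamics without perturbation of the first
channel. -/
theorem superTwisting_decrease {u v σ q : ℝ} (hσ : σ ∈ signSet u) (hq : |q| ≤ 1) :
    (12 * (√|u| * Real.sign u) - 4 * v) * (-3 * √|u| * Real.sign u + v)
      + (-4 * u + |v| * v) * (-2 * σ - q) ≤ -(2 / 5) * (|u| + v ^ 2) := by
  obtain ⟨hq₁, hq₂⟩ := abs_le.1 hq
  have hs := Real.sqrt_nonneg |u|
  have hsq := Real.sq_sqrt (abs_nonneg u)
  rcases lt_trichotomy u 0 with h | h | h
  · have hσ' : σ = -1 := by simpa [signSet, h, h.not_gt] using hσ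
    have key := superTwisting_quadratic (w := -v) (c := 2 - q) hs (by linarith) (by linarith)
    rw [abs_neg, hsq] at key
    rw [Real.sign_of_neg h, hσ']
    rw [abs_of_neg h] at *
    linear_combination key
  · subst h
    have hσ' : σ ∈ Icc (-1 : ℝ) 1 := by simpa [signSet] using hσ
    -- On the switching line any Filippov value is harmless: `-4 v² + 3 v² = -v²`.
    have h1 : |2 * σ + q| ≤ 3 := abs_le.2 ⟨by linarith [hσ'.1], by linarith [hσ'.2]⟩
    have h2 : -(|v| * v * (2 * σ + q)) ≤ |v| * |v| * 3 := by
      refine (neg_le_abs _).trans ?_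
      rw [abs_mul, abs_mul, abs_abs]
      gcongr
    rw [abs_mul_abs_self] at h2
    simp only [abs_zero, Real.sqrt_zero]
    nlinarith [sq_nonneg v]
  · have hσ' : σ = 1 := by simpa [signSet, h] using hσ
    have key := superTwisting_quadratic (w := v) (c := 2 + q) hs (by linarith) (by linarith)
    rw [hsq] at key
    rw [Real.sign_of_pos h, hσ']
    rw [abs_of_pos h] at *
    linear_combination key

theorem abs_lyapunov_gradient_le (u v : ℝ) :
    |12 * (√|u| * Real.sign u) - 4 * v| ≤ 13 * √(|u| + v ^ 2) := by
  have hN : 0 ≤ |u| + v ^ 2 := by positivity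
  refine abs_le_of_sq_le_sq ?_ (by positivity)
  rw [mul_pow, Real.sq_sqrt hN]
  have hsq := Real.sq_sqrt (abs_nonneg u)
  have hsgn : (√|u| * Real.sign u) ^ 2 ≤ |u| := by
    rw [mul_pow, hsq]
    rcases Real.sign_apply_eq u with h | h | h <;> rw [h] <;> simp
  -- Cauchy–Schwarz, with `12² + 4² = 160 ≤ 13²`.
  nlinarith [sq_nonneg (12 * v + 4 * (√|u| * Real.sign u))]

/-- Decrease of the Lyapunov function along the perturbed dynamics, away from the origin. -/
theorem superTwisting_perturbed_decrease {u v p σ q δ₁ δ₂ : ℝ} (hσ : σ ∈ signSet u) (hq : |q| ≤ 1)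
    (hδ₁ : 0 ≤ δ₁) (hδ₂ : δ₂ ≤ 1 / 130) (hp : |p| ≤ δ₁ + δ₂ * √(|u| + v ^ 2))
    (hN : 130 * δ₁ + 1 ≤ √(|u| + v ^ 2)) :
    (12 * (√|u| * Real.sign u) - 4 * v) * (-3 * √|u| * Real.sign u + v + p)
      + (-4 * u + |v| * v) * (-2 * σ - q) ≤ -(1 / 5) := by
  have h1 := superTwisting_decrease (v := v) hσ hq
  have h0 : 0 ≤ |u| + v ^ 2 := by positivity
  have hsq := Real.sq_sqrt h0
  have h2 : (12 * (√|u| * Real.sign u) - 4 * v) * p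
      ≤ 13 * √(|u| + v ^ 2) * (δ₁ + δ₂ * √(|u| + v ^ 2)) := by
    refine (le_abs_self _).trans ?_
    rw [abs_mul]
    exact mul_le_mul (abs_lyapunov_gradient_le u v) hp (abs_nonneg _) (by positivity)
  set N := √(|u| + v ^ 2)
  have h3 : 13 * N * (δ₁ + δ₂ * N) ≤ 1 / 5 * N ^ 2 := by
    nlinarith [mul_nonneg (show 0 ≤ N by linarith) (show 0 ≤ N - 130 * δ₁ by linarith),
      mul_nonneg (sub_nonneg.2 hδ₂) (sq_nonneg N)]
  nlinarith

/-- Uniform ultimate boundedness of the perturbed super-twisting dynamics. -/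
theorem superTwisting_ultimate_bound {u v p σ q : ℝ → ℝ} {δ₁ δ₂ : ℝ} (hδ₁ : 0 ≤ δ₁)
    (hδ₂ : δ₂ ≤ 1 / 130) (hu : LocallyAC u) (hv : LocallyAC v)
    (hdyn : ∀ᵐ t ∂volume.restrict (Ici (0 : ℝ)),
      HasDerivAt u (-3 * √|u t| * Real.sign (u t) + v t + p t) t ∧
      HasDerivAt v (-2 * σ t - q t) t ∧ σ t ∈ signSet (u t) ∧ |q t| ≤ 1 ∧
      |p t| ≤ δ₁ + δ₂ * √(|u t| + v t ^ 2))
    {a t₀ t : ℝ} (ht₀ : 0 ≤ t₀) (hua : |u t₀| ≤ a) (hva : |v t₀| ≤ a)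
    (ht : t₀ + 65 * (a + 1) ^ 3 ≤ t) :
    |u t| ≤ (13 * (130 * δ₁ + 1) ^ 3 + 1) ^ 2 ∧ |v t| ≤ 12 * (13 * (130 * δ₁ + 1) ^ 3) + 1 := by
  set R := 130 * δ₁ + 1 with hR
  have hR0 : 0 ≤ R := by positivity
  have ha : 0 ≤ a := (abs_nonneg _).trans hua
  have hle := (locallyAC_lyapunov hu hv).le_max_of_deriv_le (M := 13 * R ^ 3) (η := 1 / 5)
    (by norm_num) (by
      filter_upwards [hdyn] with s ⟨h1, h2, h3, h4, h5⟩ hM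
      rw [(hasDerivAt_lyapunov h1 h2).deriv]
      refine superTwisting_perturbed_decrease h3 h4 hδ₁ hδ₂ h5 ?_
      by_contra! hN
      -- If `N < R`, both `√|u|` and `|v|` are below `R`, which puts the state in the sublevel set.
      refine hM.not_ge (lyapunov_le ?_ ?_)
      · exact (Real.sqrt_le_sqrt (by nlinarith [sq_nonneg (v s)])).trans hN.le
      · exact (Real.abs_le_sqrt (by nlinarith [abs_nonneg (u s)])).trans hN.le)
    ht₀ (show t₀ ≤ t by nlinarith [pow_nonneg (show 0 ≤ a + 1 by linarith) 3])
  have h0 : lyapunov (u t₀) (v t₀) ≤ 13 * (a + 1) ^ 3 := by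
    refine lyapunov_le ?_ (by linarith)
    rw [Real.sqrt_le_left (by linarith)]
    nlinarith
  -- At rate `1/5`, the initial value `13 (a + 1)³` is used up within time `65 (a + 1)³`.
  rw [max_eq_left (by nlinarith [pow_nonneg hR0 3])] at hle
  have hlow := (le_lyapunov (u t) (v t)).trans hle
  set M := 13 * R ^ 3
  have hM : 0 ≤ M := by positivity
  have hs := Real.sqrt_nonneg |u t|
  have hw := abs_nonneg (v t)
  have cube : ∀ {x B : ℝ}, 0 ≤ x → 0 ≤ B → x ^ 3 ≤ B → x ≤ B + 1 := by
    intro x B hx hB h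
    by_contra! hlt
    have h1 : 1 < x ^ 2 := by nlinarith
    nlinarith
  have h1 : √|u t| ≤ M + 1 := cube hs hM (by nlinarith [pow_nonneg hw 3])
  refine ⟨?_, cube hw (by positivity) (by nlinarith [pow_nonneg hs 3])⟩
  rw [← Real.sq_sqrt (abs_nonneg (u t))]
  gcongr

/-! ### Coordinates of the network maps -/

theorem lin_apply {k l : ℕ} (A : Matrix (Fin l) (Fin k) ℝ) (v : Vec k) (i : Fin l) :
    lin A v i = ∑ j, A i j * v j := rfl

theorem hadamard_apply {k : ℕ} (u v : Vec k) (j : Fin k) : hadamard u v j = u j * v j := rfl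

theorem reluDeriv_apply {k : ℕ} (a : Vec k) (j : Fin k) :
    reluDeriv a j = if 0 ≤ a j then 1 else 0 := rfl

theorem preact_apply {d : ℕ → ℕ} (θ : Params d) (x : Vec (d 0)) (i : ℕ) (j : Fin (d (i + 1))) :
    preact θ x i j = ∑ k, θ.W i j k * feature θ x i k + θ.b i j := rfl

/-! ### Time derivatives of the features -/

/-- A differentiable function vanishes with nonzero derivative only on a countable set. -/
theorem countable_zero_of_deriv_ne_zero (f f' : ℝ → ℝ) :
    {t | HasDerivAt f (f' t) t ∧ f t = 0 ∧ f' t ≠ 0}.Countable := by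
  refine (countable_setOfPred_isolated_right_within (s := {t | f t = 0})).mono ?_
  rintro t ⟨hd, h0, hne⟩
  refine ⟨h0, ?_⟩
  have h := hd.eventually_ne (c := 0) hne
  rw [← Filter.empty_mem_iff_bot, mem_nhdsWithin_iff_eventually]
  rw [eventually_nhdsWithin_iff] at h
  filter_upwards [h] with s hs hmem
  exact hs (ne_of_gt hmem.2) hmem.1

/-- The value chosen for `φ'(0)` is immaterial: at almost every zero of `f` the derivative vanishes
too. This makes `Γ` the true feature velocity, weighted by `W_L`, for almost every `t`. -/
theorem ae_hasDerivAt_max_zero {f f' : ℝ → ℝ} (h : ∀ᵐ t, HasDerivAt f (f' t) t) :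
    ∀ᵐ t, HasDerivAt (fun s => max 0 (f s)) ((if 0 ≤ f t then 1 else 0) * f' t) t := by
  filter_upwards [h, (countable_zero_of_deriv_ne_zero f f').ae_notMem volume] with t hd hnot
  rcases lt_trichotomy (f t) 0 with hf | hf | hf
  · rw [if_neg hf.not_ge, zero_mul]
    refine (hasDerivAt_const t (0 : ℝ)).congr_of_eventuallyEq ?_
    filter_upwards [hd.continuousAt.eventually_lt_const hf] with s hs
    exact max_eq_left hs.le
  · have h0 : f' t = 0 := by
      by_contra hne
      exact hnot ⟨hd, hf, hne⟩
    rw [h0] at hd ⊢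
    rw [mul_zero]
    rw [hasDerivAt_iff_isLittleO] at hd ⊢
    refine (Asymptotics.IsBigO.of_bound 1 (Filter.Eventually.of_forall fun s => ?_)).trans_isLittleO hd
    simp only [hf, max_self, smul_zero, sub_zero, Real.norm_eq_abs, one_mul]
    rw [abs_of_nonneg (le_max_left 0 (f s))]
    exact max_le (abs_nonneg _) (le_abs_self _)
  · rw [if_pos hf.le, one_mul]
    refine hd.congr_of_eventuallyEq ?_
    filter_upwards [hd.continuousAt.eventually_const_lt hf] with s hs
    exact max_eq_right hs.le

theorem hasDerivAt_apply {m : ℕ} {f : ℝ → Vec m} {f' : Vec m} {t : ℝ} (h : HasDerivAt f f' t)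
    (i : Fin m) : HasDerivAt (fun s => f s i) (f' i) t :=
  (EuclideanSpace.proj (𝕜 := ℝ) i).hasFDerivAt.comp_hasDerivAt t h

theorem contDiff_apply_coord {m : ℕ} {n : WithTop ℕ∞} {f : ℝ → Vec m} (h : ContDiff ℝ n f)
    (i : Fin m) : ContDiff ℝ n fun s => f s i :=
  contDiff_euclidean.1 h i

variable {d : ℕ → ℕ}

theorem ae_hasDerivAt_feature (θ : Params d) {x : ℝ → Vec (d 0)} (hx : ContDiff ℝ 1 x) (i : ℕ) :
    ∀ᵐ t, ∀ j, HasDerivAt (fun s => feature θ (x s) i j)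
      (featureDeriv θ (x t) (deriv x t) i j) t := by
  induction i with
  | zero =>
    refine Filter.Eventually.of_forall fun t j => ?_
    exact hasDerivAt_apply ((hx.differentiable (by norm_num)) t).hasDerivAt j
  | succ i ih =>
    refine ae_all_iff.2 fun j => ?_
    have h : ∀ᵐ t, HasDerivAt (fun s => preact θ (x s) i j)
        (lin (θ.W i) (featureDeriv θ (x t) (deriv x t) i) j) t := by
      filter_upwards [ih] with t ht
      simp only [preact_apply, lin_apply]
      exact (HasDerivAt.fun_sum fun k _ => (ht k).const_mul (θ.W i j k)).add_const _
    exact ae_hasDerivAt_max_zero h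

theorem locallyAC_feature (θ : Params d) {x : ℝ → Vec (d 0)} (hx : ContDiff ℝ 1 x) (i : ℕ)
    (j : Fin (d i)) : LocallyAC fun t => feature θ (x t) i j := by
  induction i with
  | zero => exact LocallyAC.of_contDiff (contDiff_apply_coord hx j)
  | succ i ih =>
    have h : LocallyAC fun t => preact θ (x t) i j := by
      simp only [preact_apply]
      exact (LocallyAC.sum _ fun k => (ih k).const_mul _).add (LocallyAC.const _)
    exact h.comp (LocallyLipschitz.id.const_max 0)

/-! ### Error dynamics -/

section ErrorDynamics

variable {θ : Params d} {H : ℕ} {k₁ k₂ : ℝ} {x vhat : ℝ → Vec (d 0)} {y : ℝ → Vec (d (H + 1))}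
  {WL : ℝ → Matrix (Fin (d (H + 1))) (Fin (d H)) ℝ} {bL z₂ : ℝ → Vec (d (H + 1))}

theorem err₁_apply (t : ℝ) (i : Fin (d (H + 1))) :
    err₁ θ H x y WL bL t i = ∑ j, WL t i j * feature θ (x t) H j + bL t i - y t i := rfl

theorem err₂_apply (t : ℝ) (i : Fin (d (H + 1))) : err₂ y z₂ t i = z₂ t i - deriv y t i := rfl

theorem locallyAC_err₁ (hx : ContDiff ℝ 1 x) (hy : ContDiff ℝ 2 y)
    (hsol : IsOnlineSolution θ H k₁ k₂ x vhat y WL bL z₂) (i : Fin (d (H + 1))) :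
    LocallyAC fun t => err₁ θ H x y WL bL t i := by
  simp only [err₁_apply]
  exact ((LocallyAC.sum _ fun j => (hsol.ac_weight i j).mul (locallyAC_feature θ hx H j)).add
    (hsol.ac_bias i)).sub
    (LocallyAC.of_contDiff (contDiff_apply_coord (hy.of_le (by norm_num)) i))

theorem contDiff_deriv_target {m : ℕ} {y : ℝ → Vec m} (hy : ContDiff ℝ 2 y) :
    ContDiff ℝ 1 (deriv y) :=
  ((contDiff_succ_iff_deriv (n := 1)).1 (by rw [one_add_one_eq_two]; exact hy)).2.2

theorem locallyAC_err₂ (hy : ContDiff ℝ 2 y)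
    (hsol : IsOnlineSolution θ H k₁ k₂ x vhat y WL bL z₂) (i : Fin (d (H + 1))) :
    LocallyAC fun t => err₂ y z₂ t i := by
  simp only [err₂_apply]
  exact (hsol.ac_integral i).sub
    (LocallyAC.of_contDiff (contDiff_apply_coord (contDiff_deriv_target hy) i))

/-- The normalized weight update acts on the output like a second copy of the bias update; together
they cancel the factor `1/2` in the laws. -/
theorem sum_mul_div_norm_sq_mul {m : ℕ} {f : Vec m} (hf : f ≠ 0) (r : ℝ) :
    ∑ j, r * f j / ‖f‖ ^ 2 * f j = r := by
  have hn : ‖f‖ ^ 2 ≠ 0 := by simpa using hf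
  have h : ∑ j, f j ^ 2 = ‖f‖ ^ 2 := by rw [EuclideanSpace.real_norm_sq_eq]
  calc ∑ j, r * f j / ‖f‖ ^ 2 * f j = r / ‖f‖ ^ 2 * ∑ j, f j ^ 2 := by
        rw [Finset.mul_sum]
        exact Finset.sum_congr rfl fun j _ => by ring
    _ = r := by rw [h, div_mul_cancel₀ _ hn]

/-- The first error obeys the perturbed super-twisting law. -/
theorem ae_hasDerivAt_err₁ (hx : ContDiff ℝ 1 x) (hy : ContDiff ℝ 2 y)
    (hsol : IsOnlineSolution θ H k₁ k₂ x vhat y WL bL z₂) :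
    ∀ᵐ t ∂volume.restrict (Ici (0 : ℝ)), ∀ i,
      HasDerivAt (fun s => err₁ θ H x y WL bL s i)
        (-k₁ * √|err₁ θ H x y WL bL t i| * Real.sign (err₁ θ H x y WL bL t i) + err₂ y z₂ t i
          + (Gam θ H (WL t) (x t) (deriv x t) i - Gam θ H (WL t) (x t) (vhat t) i)) t := by
  filter_upwards [hsol.feature_ne_zero, hsol.bias_law, hsol.weight_law,
    ae_restrict_of_ae (ae_hasDerivAt_feature θ hx H)] with t hne hb hW hf i
  have hy' := hasDerivAt_apply ((hy.differentiable (by norm_num)) t).hasDerivAt i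
  have h := ((HasDerivAt.fun_sum fun j (_ : j ∈ Finset.univ) => (hW i j).mul (hf j)).add
    (hb i)).sub hy'
  refine h.congr_deriv ?_
  rw [Finset.sum_add_distrib, sum_mul_div_norm_sq_mul hne, err₂_apply]
  have hG : Gam θ H (WL t) (x t) (deriv x t) i
      = ∑ j, WL t i j * featureDeriv θ (x t) (deriv x t) H j := rfl
  rw [hG, biasRate]
  ring

theorem ae_hasDerivAt_err₂ (hy : ContDiff ℝ 2 y)
    (hsol : IsOnlineSolution θ H k₁ k₂ x vhat y WL bL z₂) :
    ∀ᵐ t ∂volume.restrict (Ici (0 : ℝ)), ∀ i, ∃ s ∈ signSet (err₁ θ H x y WL bL t i),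
      HasDerivAt (fun s => err₂ y z₂ s i) (-k₂ * s - deriv (deriv y) t i) t := by
  filter_upwards [hsol.integral_law] with t ht i
  obtain ⟨s, hs, hd⟩ := ht i
  exact ⟨s, hs, hd.sub (hasDerivAt_apply
    (((contDiff_deriv_target hy).differentiable (by norm_num)) t).hasDerivAt i)⟩

theorem sign_div_of_pos {D : ℝ} (hD : 0 < D) (u : ℝ) : Real.sign (u / D) = Real.sign u := by
  rcases lt_trichotomy u 0 with h | h | h
  · rw [Real.sign_of_neg h, Real.sign_of_neg (div_neg_of_neg_of_pos h hD)]
  · simp [h]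
  · rw [Real.sign_of_pos h, Real.sign_of_pos (div_pos h hD)]

theorem signSet_div_of_pos {D : ℝ} (hD : 0 < D) (u : ℝ) : signSet (u / D) = signSet u := by
  simp only [signSet, div_pos_iff_of_pos_right hD, div_neg_iff, hD, hD.not_gt, and_true, and_false,
    false_or]

/-- Each pair of error components enters a fixed box, uniformly in the initial time. -/
theorem err_ultimate_bound {Dy δ₁ δ₂ : ℝ} (hDy : 0 < Dy) (hδ₁ : 0 ≤ δ₁) (hδ₂ : 0 ≤ δ₂)
    (hδ₂' : δ₂ < Dy / (130 * (Dy + 1))) (hx : ContDiff ℝ 1 x) (hy : ContDiff ℝ 2 y)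
    (hyD : ∀ t, 0 ≤ t → ∀ i, |deriv (deriv y) t i| ≤ Dy)
    (hsol : IsOnlineSolution θ H (3 * √Dy) (2 * Dy) x vhat y WL bL z₂)
    (hpert : PerturbationBound θ H δ₁ δ₂ x vhat y WL bL z₂) (i : Fin (d (H + 1)))
    {a t₀ t : ℝ} (ht₀ : 0 ≤ t₀) (h₁ : |err₁ θ H x y WL bL t₀ i| ≤ a) (h₂ : |err₂ y z₂ t₀ i| ≤ a)
    (ht : t₀ + 65 * (a / Dy + 1) ^ 3 ≤ t) :
    |err₁ θ H x y WL bL t i| ≤ Dy * (13 * (130 * (δ₁ / Dy) + 1) ^ 3 + 1) ^ 2 ∧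
      |err₂ y z₂ t i| ≤ Dy * (12 * (13 * (130 * (δ₁ / Dy) + 1) ^ 3) + 1) := by
  -- Selects the Filippov value as a function of all times, with default 0 where the law fails; no
  -- measurability is needed.
  have hex : ∀ t, ∃ s, (∃ s' ∈ signSet (err₁ θ H x y WL bL t i),
      HasDerivAt (fun s => err₂ y z₂ s i) (-(2 * Dy) * s' - deriv (deriv y) t i) t) →
      s ∈ signSet (err₁ θ H x y WL bL t i) ∧
      HasDerivAt (fun s => err₂ y z₂ s i) (-(2 * Dy) * s - deriv (deriv y) t i) t := by
    intro t
    by_cases h : ∃ s' ∈ signSet (err₁ θ H x y WL bL t i),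
      HasDerivAt (fun s => err₂ y z₂ s i) (-(2 * Dy) * s' - deriv (deriv y) t i) t
    · exact ⟨h.choose, fun _ => h.choose_spec⟩
    · exact ⟨0, fun h' => absurd h' h⟩
  choose σ hσ using hex
  have habs : ∀ r : ℝ, |r / Dy| = |r| / Dy := fun r => by rw [abs_div, abs_of_pos hDy]
  have key := superTwisting_ultimate_bound (u := fun t => err₁ θ H x y WL bL t i / Dy)
    (v := fun t => err₂ y z₂ t i / Dy)
    (p := fun t => (Gam θ H (WL t) (x t) (deriv x t) i - Gam θ H (WL t) (x t) (vhat t) i) / Dy)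
    (σ := σ) (q := fun t => deriv (deriv y) t i / Dy) (δ₁ := δ₁ / Dy)
    -- Rescaling gives `√(|e₁| + e₂²) ≤ (Dy + 1) √(|u| + v²)`; hence the threshold `Dy / (130 (Dy +
    -- 1))`.
    (δ₂ := δ₂ * (Dy + 1) / Dy) (a := a / Dy) (t₀ := t₀) (t := t) (by positivity)
    (by
      rw [lt_div_iff₀ (by positivity)] at hδ₂'
      rw [div_le_div_iff₀ hDy (by norm_num)]
      linarith)
    (by simpa only [div_eq_inv_mul] using (locallyAC_err₁ hx hy hsol i).const_mul Dy⁻¹)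
    (by simpa only [div_eq_inv_mul] using (locallyAC_err₂ hy hsol i).const_mul Dy⁻¹)
    (by
      filter_upwards [ae_hasDerivAt_err₁ hx hy hsol, ae_hasDerivAt_err₂ hy hsol, hpert,
        ae_restrict_mem measurableSet_Ici] with s h1 h2 h3 hs
      obtain ⟨hmem, hd⟩ := hσ s (h2 i)
      refine ⟨((h1 i).div_const Dy).congr_deriv ?_, (hd.div_const Dy).congr_deriv ?_, ?_, ?_, ?_⟩
      · rw [sign_div_of_pos hDy, habs, Real.sqrt_div (abs_nonneg _)]
        have hr : √Dy ≠ 0 := (Real.sqrt_pos.2 hDy).ne'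
        field_simp
        linear_combination (-3 * √|err₁ θ H x y WL bL s i| * Real.sign (err₁ θ H x y WL bL s i))
          * Real.sq_sqrt hDy.le
      · field_simp
      · rwa [signSet_div_of_pos hDy]
      · rw [habs, div_le_one hDy]
        exact hyD s hs i
      · rw [habs, mul_div_right_comm, mul_assoc, div_mul_eq_mul_div, ← add_div]
        gcongr
        refine (h3 i).trans ?_
        gcongr
        rw [← Real.sqrt_sq (show 0 ≤ Dy + 1 by linarith), ← Real.sqrt_mul (sq_nonneg _)]
        refine Real.sqrt_le_sqrt ?_
        have e1 : |err₁ θ H x y WL bL s i| = Dy * |err₁ θ H x y WL bL s i / Dy| := by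
          rw [habs]; field_simp
        have e2 : err₂ y z₂ s i = Dy * (err₂ y z₂ s i / Dy) := by field_simp
        have aux : ∀ A B : ℝ, 0 ≤ A → Dy * A + (Dy * B) ^ 2 ≤ (Dy + 1) ^ 2 * (A + B ^ 2) := by
          intro A B hA
          nlinarith [sq_nonneg B, mul_nonneg hDy.le (sq_nonneg B), mul_nonneg (sq_nonneg Dy) hA,
            mul_nonneg hDy.le hA]
        have h := aux _ (err₂ y z₂ s i / Dy) (abs_nonneg (err₁ θ H x y WL bL s i / Dy))
        rwa [← e1, ← e2] at h)
    ht₀ (by rw [habs]; gcongr) (by rw [habs]; gcongr) ht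
  simp only [habs, div_le_iff₀' hDy] at key
  exact key

end ErrorDynamics

theorem abs_apply_le_norm {m : ℕ} (v : Vec m) (i : Fin m) : |v i| ≤ ‖v‖ := by
  simpa using PiLp.norm_apply_le v i

theorem norm_le_card_mul {m : ℕ} (v : Vec m) {c : ℝ} (h : ∀ i, |v i| ≤ c) :
    ‖v‖ ≤ m * c := by
  have hs : v = ∑ i, EuclideanSpace.single i (v i) := by
    ext j
    simp [Finset.sum_apply]
  calc ‖v‖ = ‖∑ i, EuclideanSpace.single i (v i)‖ := by rw [← hs]
    _ ≤ ∑ i, |v i| := (norm_sum_le _ _).trans (by simp)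
    _ ≤ ∑ _i : Fin m, c := Finset.sum_le_sum fun i _ => h i
    _ = m * c := by simp

theorem globallyUltimatelyBounded_errorTrajectories (H : ℕ) (γ : ℝ) {Dy δ₁ δ₂ : ℝ}
    (hDy : 0 < Dy) (hδ₁ : 0 ≤ δ₁) (hδ₂ : 0 ≤ δ₂) (hδ₂' : δ₂ < Dy / (130 * (Dy + 1))) :
    GloballyUltimatelyBounded (errorTrajectories d H γ Dy (3 * √Dy) (2 * Dy) δ₁ δ₂) := by
  set B := Dy * (13 * (130 * (δ₁ / Dy) + 1) ^ 3 + 1) ^ 2 with hB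
  set C := Dy * (12 * (13 * (130 * (δ₁ / Dy) + 1) ^ 3) + 1) with hC
  have hB0 : 0 < B := by positivity
  -- The bound may depend on the output width; `+ 1` keeps it positive for width 0.
  refine ⟨d (H + 1) * max B C + 1, by positivity, fun a ha =>
    ⟨65 * (a / Dy + 1) ^ 3, by positivity, ?_⟩⟩
  rintro e ⟨θ, x, vhat, y, WL, bL, z₂, -, hx, hy, hyD, hsol, hpert, he⟩ t₀ ht₀ hea t ht
  rw [he, Prod.norm_def, max_le_iff] at hea
  have h := fun i => err_ultimate_bound hDy hδ₁ hδ₂ hδ₂' hx hy hyD hsol hpert i ht₀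
    ((abs_apply_le_norm _ i).trans hea.1) ((abs_apply_le_norm _ i).trans hea.2) ht
  rw [he, Prod.norm_def]
  refine max_le ?_ ?_
  · exact (norm_le_card_mul _ fun i => (h i).1.trans (le_max_left B C)).trans (by linarith)
  · exact (norm_le_card_mul _ fun i => (h i).2.trans (le_max_right B C)).trans (by linarith)

/-! ### Lipschitz bounds for spectrally normalized networks -/

theorem sigmaMax_normalizeMatrix_le {k l : ℕ} {c : ℝ} (hc : 0 ≤ c)
    (A : Matrix (Fin l) (Fin k) ℝ) : sigmaMax (normalizeMatrix c A) ≤ c := by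
  unfold normalizeMatrix
  split_ifs with h
  · have hpos : 0 < sigmaMax A := hc.trans_lt h
    have hl : lin ((c / sigmaMax A) • A) = (c / sigmaMax A) • lin A := by
      ext v
      simp [lin]
    rw [sigmaMax, hl, norm_smul, Real.norm_of_nonneg (by positivity)]
    exact (div_mul_cancel₀ c hpos.ne').le
  · exact not_lt.1 h

/-- Training ends with a normalization, so nothing about the optimizer matters. -/
theorem IsSpectrallyTrained.sigmaMax_le {γ : ℝ} (hγ : 0 < γ) {H : ℕ} {θ : Params d}
    (h : IsSpectrallyTrained γ H θ) {i : ℕ} (hi : i ≤ H) :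
    sigmaMax (θ.W i) ≤ γ ^ (1 / ((H : ℝ) + 1)) := by
  obtain ⟨opt, θ₀, n, hn, rfl⟩ := h
  obtain ⟨n, rfl⟩ := Nat.exists_eq_add_of_le' hn
  have hW : (train γ H opt θ₀ (n + 1)).W i = normalizeMatrix (γ ^ (1 / ((H : ℝ) + 1)))
      ((opt n (train γ H opt θ₀ n)).W i) := by
    simp [train, normalizeLayers, hi]
  rw [hW]
  exact sigmaMax_normalizeMatrix_le (by positivity) _

theorem featureDeriv_sub (θ : Params d) (x v w : Vec (d 0)) (i : ℕ) :
    featureDeriv θ x v i - featureDeriv θ x w i = featureDeriv θ x (v - w) i := by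
  induction i with
  | zero => rfl
  | succ i ih =>
    simp only [featureDeriv, ← ih, map_sub]
    ext j
    simp only [PiLp.sub_apply, hadamard_apply]
    ring

theorem norm_hadamard_reluDeriv_le {k : ℕ} (a v : Vec k) : ‖hadamard (reluDeriv a) v‖ ≤ ‖v‖ := by
  rw [EuclideanSpace.norm_eq, EuclideanSpace.norm_eq]
  refine Real.sqrt_le_sqrt (Finset.sum_le_sum fun j _ => ?_)
  rw [hadamard_apply, reluDeriv_apply]
  split_ifs <;> simp [sq_nonneg]

theorem norm_featureDeriv_le {θ : Params d} {c : ℝ} (hc : 0 ≤ c) {i : ℕ}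
    (h : ∀ j < i, sigmaMax (θ.W j) ≤ c) (x v : Vec (d 0)) :
    ‖featureDeriv θ x v i‖ ≤ c ^ i * ‖v‖ := by
  induction i with
  | zero => simp [featureDeriv]
  | succ i ih =>
    calc ‖featureDeriv θ x v (i + 1)‖ ≤ ‖lin (θ.W i) (featureDeriv θ x v i)‖ :=
          norm_hadamard_reluDeriv_le _ _
      _ ≤ sigmaMax (θ.W i) * ‖featureDeriv θ x v i‖ := (lin (θ.W i)).le_opNorm _
      _ ≤ c * (c ^ i * ‖v‖) := by
          gcongr
          · exact h i i.lt_succ_self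
          · exact ih fun j hj => h j (hj.trans i.lt_succ_self)
      _ = c ^ (i + 1) * ‖v‖ := by ring

theorem norm_Gam_sub_le {γ : ℝ} (hγ : 0 < γ) {H : ℕ} {θ : Params d}
    (h : IsSpectrallyTrained γ H θ) (WL : Matrix (Fin (d (H + 1))) (Fin (d H)) ℝ)
    (x v w : Vec (d 0)) :
    ‖Gam θ H WL x v - Gam θ H WL x w‖
      ≤ sigmaMax WL * γ ^ ((H : ℝ) / ((H : ℝ) + 1)) * ‖v - w‖ := by
  have hpow : (γ ^ (1 / ((H : ℝ) + 1))) ^ H = γ ^ ((H : ℝ) / ((H : ℝ) + 1)) := by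
    rw [← Real.rpow_natCast, ← Real.rpow_mul hγ.le, one_div_mul_eq_div]
  rw [Gam, Gam, ← map_sub, featureDeriv_sub, mul_assoc, ← hpow]
  refine ((lin WL).le_opNorm _).trans (mul_le_mul_of_nonneg_left ?_ (norm_nonneg _))
  exact norm_featureDeriv_le (by positivity) (fun j hj => h.sigmaMax_le hγ hj.le) x _

theorem norm_Gam_trained_sub_le {γ : ℝ} (hγ : 0 < γ) {H : ℕ} {θ : Params d}
    (h : IsSpectrallyTrained γ H θ) (x v w : Vec (d 0)) :
    ‖Gam θ H (θ.W H) x v - Gam θ H (θ.W H) x w‖ ≤ γ * ‖v - w‖ := by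
  refine (norm_Gam_sub_le hγ h (θ.W H) x v w).trans ?_
  gcongr
  calc sigmaMax (θ.W H) * γ ^ ((H : ℝ) / ((H : ℝ) + 1))
      ≤ γ ^ (1 / ((H : ℝ) + 1)) * γ ^ ((H : ℝ) / ((H : ℝ) + 1)) := by
        gcongr
        exact h.sigmaMax_le hγ le_rfl
    _ = γ := by
        rw [← Real.rpow_add hγ, ← add_div, add_comm (1 : ℝ), div_self (by positivity),
          Real.rpow_one]

end OnlineDNN

end

theorem theorem2 (Dy : ℝ) (hDy : 0 < Dy) :
    ∃ k₁ k₂ δbar : ℝ, 0 < k₁ ∧ 0 < k₂ ∧ 0 < δbar ∧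
      ∀ (d : ℕ → ℕ) (H : ℕ) (γ : ℝ), 0 < γ →
        (∀ δ₁ δ₂ : ℝ, 0 ≤ δ₁ → 0 ≤ δ₂ → δ₂ < δbar →
          OnlineDNN.GloballyUltimatelyBounded
            (OnlineDNN.errorTrajectories d H γ Dy k₁ k₂ δ₁ δ₂)) ∧
        (∀ θ : OnlineDNN.Params d, OnlineDNN.IsSpectrallyTrained γ H θ →
          (∀ x v vhat : OnlineDNN.Vec (d 0),
            ‖OnlineDNN.Gam θ H (θ.W H) x v - OnlineDNN.Gam θ H (θ.W H) x vhat‖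
              ≤ γ * ‖v - vhat‖) ∧
          (∀ (WL : Matrix (Fin (d (H + 1))) (Fin (d H)) ℝ) (x v vhat : OnlineDNN.Vec (d 0)),
            ‖OnlineDNN.Gam θ H WL x v - OnlineDNN.Gam θ H WL x vhat‖
              ≤ OnlineDNN.sigmaMax WL * γ ^ ((H : ℝ) / ((H : ℝ) + 1)) * ‖v - vhat‖)) :=
  ⟨3 * √Dy, 2 * Dy, Dy / (130 * (Dy + 1)), by positivity, by positivity, by positivity,
    fun _ H γ hγ =>
    ⟨fun _ _ hδ₁ hδ₂ hδ₂' =>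
      OnlineDNN.globallyUltimatelyBounded_errorTrajectories H γ hDy hδ₁ hδ₂ hδ₂',
    fun _ hθ => ⟨OnlineDNN.norm_Gam_trained_sub_le hγ hθ, OnlineDNN.norm_Gam_sub_le hγ hθ⟩⟩⟩
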